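/- **Conventions.** $C^*$-algebras are unital, $^*$-homomorphisms between them are unital, $\otimes$ is the minimal tensor product, and $[n]=\{1,\dots,n\}$. A *two-coloured partition* $p$ with $k$ upper and $l$ lower points is a partition of these $k+l$ points into non-empty blocks, together with colours $\omega\in\{1,*\}^k$ of the upper and $\omega'\in\{1,*\}^l$ of the lower points. A *through-block* is a block with both upper and lower points. A labeling of a row of points is *valid* if points of the row in the same block have the same label. Fix $N$, and let $i$ run through the labelings of the through-blocks of $p$ by elements of $[N]$. Let $T_i\subseteq[N]^k$ (resp. $T'_i\subseteq[N]^l$) be the set of all valid labelings of the upper (resp. lower) row that restrict to $i$ on the through-block points, and let $T_0$ (resp. $T'_0$) be the set of invalid labelings of the upper (resp. lower) row. For $d\le N$ and a family $x=(x_{ij})_{i\in[N],\,j\in[d]}$ in a $C^*$-algebra, the relations $R^{Sp}_p(x)$ are 1. $\sum_{t\in T_i}x_{t_1\gamma_1}^{\omega_1}\cdots x_{t_k\gamma_k}^{\omega_k}=\sum_{t'\in T'_i}x_{t'_1\gamma'_1}^{\omega'_1}\cdots x_{t'_l\gamma'_l}^{\omega'_l}$ for all through-block labelings $i,j$ and all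 $\gamma\in T_j\cap[d]^k$, $\gamma'\in T'_j\cap[d]^l$; 2. $\sum_{t\in T_i}x_{t_1\gamma_1}^{\omega_1}\cdots x_{t_k\gamma_k}^{\omega_k}=0$ for all $i$ and all $\gamma\in T_0\cap[d]^k$; 3. $\sum_{t'\in T'_i}x_{t'_1\gamma'_1}^{\omega'_1}\cdots x_{t'_l\gamma'_l}^{\omega'_l}=0$ for all $i$ and all $\gamma'\in T'_0\cap[d]^l$, where an empty product is $1$. Let $1\le d\le N$ and let $\Pi$ be a set of two-coloured partitions containing the four mixed-coloured pair partitions (one block consisting of two points of different colours, both in the lower row or both in the upper row). Then $C(X_{N,d}(\Pi))$ denotes the universal unital $C^*$-algebra generated by elements $x_{ij}$ ($i\in[N]$, $j\in[d]$) subject to the relations $R^{Sp}_p(x)$ for all $p\in\Pi$. A *compact matrix quantum group* $G$ with matrix of generators $v=(v_{ij})_{i,j\in[N]}$ is given by a unital $C^*$-algebra $C(G)$ generated by the $v_{ij}$ such that $(v_{ij})$ and $(v_{ij}^*)$ are invertible matrices and there is a $^*$-homomorphism $\Delta:C(G)\to C(G)\otimes C(G)$ with $\Delta(v_{ij})=\sum_k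 v_{ik}\otimes v_{kj}$. It acts on $X_{N,d}(\Pi)$ from the left (resp. right) if there is a $^*$-homomorphism $C(X_{N,d}(\Pi))\to C(G)\otimes C(X_{N,d}(\Pi))$ with $x_{ij}\mapsto\sum_k v_{ik}\otimes x_{kj}$ (resp. $x_{ij}\mapsto\sum_k v_{ki}\otimes x_{kj}$). $G$ is the *quantum symmetry group* of $X_{N,d}(\Pi)$ if it acts from the left and from the right and if, for every compact matrix quantum group $G'$ with generators $(v'_{ij})_{i,j\in[N]}$ that acts from the left and from the right, there is a $^*$-homomorphism $C(G)\to C(G')$ with $v_{ij}\mapsto v'_{ij}$. **Theorem.** Let $1\le d\le N$, let $\Pi$ be a set of two-coloured partitions containing the four mixed-coloured pair partitions, and let $G$, with matrix of generators $v=(v_{ij})$, be the quantum symmetry group of $X_{N,d}(\Pi)$. For any $\sigma_1,\sigma_2\in S_N$ the assignments $$\phi:\ x_{ij}\mapsto v_{\sigma_1(i)\sigma_2(j)},\qquad \phi^T:\ x_{ij}\mapsto v_{\sigma_2(j)\sigma_1(i)}\qquad(i\in[N],\ j\in[d])$$ each extend uniquely to a $^*$-homomorphism $C(X_{N,d}(\Pi))\to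 C(G)$. In particular, $x_{ij}\mapsto v_{ij}$ extends uniquely to a $^*$-homomorphism $C(X_{N,d}(\Pi))\to C(G)$, and for every $p\in\Pi$ and every injective map $c:[d]\to[N]$ the relations $R^{Sp}_p$ hold for the columns $c(1),\dots,c(d)$ of $v$ and of $v^T$, that is, for $(v_{i\,c(j)})_{i\in[N],j\in[d]}$ and for $(v_{c(j)\,i})_{i\in[N],j\in[d]}$. -/

import Mathlib

noncomputable section

open scoped TensorProduct ENNReal ComplexOrder

namespace PartitionQuantumSpace

/-! ### Two-coloured partitions and their labelings -/

/-- The colours of points: `white` stands for the exponent `1`, `black` for the exponent `*`. -/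
inductive Colour
  | white
  | black

/-- A two-coloured partition with `k` upper and `l` lower points. The upper points are
`Sum.inl a`, the lower points are `Sum.inr b`, both numbered from left to right; the blocks are
the classes of the equivalence relation `blocks`. -/
structure TwoColouredPartition where
  k : ℕ
  l : ℕ
  upper : Fin k → Colour
  lower : Fin l → Colour
  blocks : Setoid (Fin k ⊕ Fin l)

namespace TwoColouredPartition

variable (p : TwoColouredPartition)

/-- The block of a point. -/
def blockOf (a : Fin p.k ⊕ Fin p.l) : Quotient p.blocks := Quotient.mk p.blocks a

/-- A block is a through-block if it contains both upper and lower points. -/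
def IsThrough (b : Quotient p.blocks) : Prop :=
  (∃ a, p.blockOf (Sum.inl a) = b) ∧ ∃ a', p.blockOf (Sum.inr a') = b

/-- The type of through-blocks. -/
def ThroughBlock : Type := {b : Quotient p.blocks // p.IsThrough b}

/-- Valid labelings of the upper row: connected upper points carry the same label. -/
def UpperValid {N : ℕ} (t : Fin p.k → Fin N) : Prop :=
  ∀ a b, p.blockOf (Sum.inl a) = p.blockOf (Sum.inl b) → t a = t b

/-- Valid labelings of the lower row: connected lower points carry the same label. -/
def LowerValid {N : ℕ} (t : Fin p.l → Fin N) : Prop :=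
  ∀ a b, p.blockOf (Sum.inr a) = p.blockOf (Sum.inr b) → t a = t b

/-- For a labeling `i` of the through-blocks by `[N]` (there are `N ^ tb(p)` of them), the set
`T_i` of all valid labelings of the upper row that label the through-blocks according to `i`. -/
def T {N : ℕ} (i : p.ThroughBlock → Fin N) : Set (Fin p.k → Fin N) :=
  {t | p.UpperValid t ∧ ∀ a (h : p.IsThrough (p.blockOf (Sum.inl a))), t a = i ⟨_, h⟩}

/-- For a labeling `i` of the through-blocks by `[N]`, the set `T'_i` of all valid labelings of the
lower row that label the through-blocks according to `i`. -/
def T' {N : ℕ} (i : p.ThroughBlock → Fin N) : Set (Fin p.l → Fin N) :=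
  {t | p.LowerValid t ∧ ∀ a (h : p.IsThrough (p.blockOf (Sum.inr a))), t a = i ⟨_, h⟩}

/-- The set `T_0` of invalid labelings of the upper row. -/
def T₀ (N : ℕ) : Set (Fin p.k → Fin N) := {t | ¬ p.UpperValid t}

/-- The set `T'_0` of invalid labelings of the lower row. -/
def T'₀ (N : ℕ) : Set (Fin p.l → Fin N) := {t | ¬ p.LowerValid t}

end TwoColouredPartition

/-- The pair partition whose two points, of colours `c₁` and `c₂`, lie in the lower row. -/
abbrev lowerPair (c₁ c₂ : Colour) : TwoColouredPartition where
  k := 0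
  l := 2
  upper := ![]
  lower := ![c₁, c₂]
  blocks := ⊤

/-- The pair partition whose two points, of colours `c₁` and `c₂`, lie in the upper row. -/
abbrev upperPair (c₁ c₂ : Colour) : TwoColouredPartition where
  k := 2
  l := 0
  upper := ![c₁, c₂]
  lower := ![]
  blocks := ⊤

/-- The four mixed-coloured pair partitions. -/
def mixedColouredPairPartitions : Set TwoColouredPartition :=
  {lowerPair .white .black, lowerPair .black .white,
    upperPair .white .black, upperPair .black .white}

/-! ### The quantum space relations -/

/-- `a ^ ω` for a colour `ω`: `a` itself or its adjoint. -/
def colourPow {A : Type*} [Star A] (a : A) : Colour → A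
  | .white => a
  | .black => star a

/-- The product `x_{t₁γ₁}^{ω₁} ⋯ x_{tₖγₖ}^{ωₖ}` (equal to `1` for `k = 0`). -/
def word {A : Type*} [Ring A] [Star A] {N d k : ℕ} (x : Fin N → Fin d → A) (ω : Fin k → Colour)
    (t : Fin k → Fin N) (γ : Fin k → Fin d) : A :=
  (List.ofFn fun m => colourPow (x (t m) (γ m)) (ω m)).prod

open Classical in
/-- The sum of the products `x_{t₁γ₁}^{ω₁} ⋯ x_{tₖγₖ}^{ωₖ}` over all `t ∈ S`. -/
def wordSum {A : Type*} [Ring A] [Star A] {N d k : ℕ} (x : Fin N → Fin d → A) (ω : Fin k → Colour)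
    (S : Set (Fin k → Fin N)) (γ : Fin k → Fin d) : A :=
  ∑ t : Fin k → Fin N with t ∈ S, word x ω t γ

/-- A multi-index in `[d]^k`, regarded as an element of `[N]^k` for `d ≤ N`. -/
def castIdx {N d k : ℕ} (hd : d ≤ N) (γ : Fin k → Fin d) : Fin k → Fin N :=
  fun m => Fin.castLE hd (γ m)

/-- The quantum space relations `R^Sp_p(x)` for a `d`-tuple `x = (x_{ij})` of vectors of length
`N` with entries in a `*`-ring. -/
structure SpaceRelations {A : Type*} [Ring A] [Star A] {N d : ℕ} (hd : d ≤ N)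
    (p : TwoColouredPartition) (x : Fin N → Fin d → A) : Prop where
  rel_eq : ∀ (i j : p.ThroughBlock → Fin N) (γ : Fin p.k → Fin d) (γ' : Fin p.l → Fin d),
    castIdx hd γ ∈ p.T j → castIdx hd γ' ∈ p.T' j →
      wordSum x p.upper (p.T i) γ = wordSum x p.lower (p.T' i) γ'
  rel_upper : ∀ (i : p.ThroughBlock → Fin N) (γ : Fin p.k → Fin d),
    castIdx hd γ ∈ p.T₀ N → wordSum x p.upper (p.T i) γ = 0
  rel_lower : ∀ (i : p.ThroughBlock → Fin N) (γ' : Fin p.l → Fin d),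
    castIdx hd γ' ∈ p.T'₀ N → wordSum x p.lower (p.T' i) γ' = 0

/-- The relation of the lower white-black pair partition: `∑_t x_{tj} x_{tj}^* = 1`. -/
theorem SpaceRelations.sum_mul_star {A : Type*} [Ring A] [Star A] {N d : ℕ} {hd : d ≤ N}
    {x : Fin N → Fin d → A} (h : SpaceRelations hd (lowerPair .white .black) x) (j : Fin d) :
    ∑ t, x t j * star (x t j) = 1 := by
  classical
  have hno : ∀ b, ¬ (lowerPair .white .black).IsThrough b := by
    rintro b ⟨⟨a, -⟩, -⟩
    exact Fin.elim0 a
  have hv : ∀ {M : ℕ} (t : Fin (lowerPair .white .black).l → Fin M),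
      (lowerPair .white .black).LowerValid t ↔ t (0 : Fin 2) = t (1 : Fin 2) := by
    intro M t
    constructor
    · intro ht
      exact ht _ _ (Quotient.sound (s := (lowerPair .white .black).blocks) trivial)
    · intro ht a b _
      change Fin 2 at a b
      fin_cases a <;> fin_cases b <;> first | rfl | exact ht | exact ht.symm
  let i : (lowerPair .white .black).ThroughBlock → Fin N := fun b => (hno _ b.2).elim
  have key := h.rel_eq i i (fun a => Fin.elim0 a) (fun _ => j)
    ⟨fun a => Fin.elim0 a, fun a => Fin.elim0 a⟩ ⟨(hv _).2 rfl, fun a ha => (hno _ ha).elim⟩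
  have h1 : wordSum x (lowerPair .white .black).upper ((lowerPair .white .black).T i)
      (fun a => Fin.elim0 a) = 1 := by
    unfold wordSum
    rw [Finset.sum_eq_single (fun a : Fin 0 => Fin.elim0 a)]
    · simp [word, lowerPair]
    · intro b _ hb
      exact (hb (funext fun a => Fin.elim0 a)).elim
    · intro hb
      exact (hb (by simp only [Finset.mem_filter, Finset.mem_univ, true_and]
                    exact ⟨fun a => Fin.elim0 a, fun a => Fin.elim0 a⟩)).elim
  rw [h1] at key
  rw [key]
  unfold wordSum
  refine Finset.sum_bij (fun t _ => (fun _ : Fin 2 => t)) ?_ ?_ ?_ ?_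
  · intro t _
    simp only [Finset.mem_filter, Finset.mem_univ, true_and]
    exact ⟨(hv _).2 rfl, fun a ha => (hno _ ha).elim⟩
  · intro a _ b _ hab
    exact congrFun hab 0
  · intro t ht
    simp only [Finset.mem_filter, Finset.mem_univ, true_and] at ht
    refine ⟨t (0 : Fin 2), Finset.mem_univ _, ?_⟩
    have := (hv t).1 ht.1
    funext m
    change Fin 2 at m
    fin_cases m
    · rfl
    · exact this
  · intro t _
    simp [word, lowerPair, colourPow, List.ofFn_succ]

/-! ### Bounded products of C⋆-algebras -/

/-- The bounded product (`ℓ^∞`-direct product) of nonzero unital C⋆-algebras is a unital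
C⋆-algebra with componentwise operations and the supremum norm. -/
instance boundedProduct {I : Type*} {B : I → Type*} [∀ i, CStarAlgebra (B i)]
    [∀ i, Nontrivial (B i)] : CStarAlgebra (lp B ∞) where
  __ := (inferInstance : NormedAlgebra ℂ (lp B ∞))
  __ := (inferInstance : StarModule ℂ (lp B ∞))
  __ := (inferInstance : CStarRing (lp B ∞))
  __ := (inferInstance : CompleteSpace (lp B ∞))

/-- The closed unital `*`-subalgebra generated by a set. -/
def closedAdjoin {B : Type*} [CStarAlgebra B] (s : Set B) : StarSubalgebra ℂ B :=
  (StarAlgebra.adjoin ℂ s).topologicalClosure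

instance {B : Type*} [CStarAlgebra B] (s : Set B) : IsClosed (closedAdjoin s : Set B) :=
  StarSubalgebra.isClosed_topologicalClosure _

theorem subset_closedAdjoin {B : Type*} [CStarAlgebra B] (s : Set B) :
    s ⊆ (closedAdjoin s : Set B) :=
  (StarAlgebra.subset_adjoin ℂ s).trans (StarSubalgebra.le_topologicalClosure _)

/-! ### The minimal tensor product of C⋆-algebras -/

section MinTensor

attribute [local instance] CStarAlgebra.spectralOrder CStarAlgebra.spectralOrderedRing

/-- The states of a unital C⋆-algebra: positive linear functionals `f` with `f 1 = 1`. Positivity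
refers to the canonical order of the C⋆-algebra. -/
def State (A : Type*) [CStarAlgebra A] : Type _ := {f : A →ₚ[ℂ] ℂ // f 1 = 1}

/-- The GNS Hilbert space of a state. -/
abbrev State.GNS {A : Type*} [CStarAlgebra A] (f : State A) : Type _ := f.1.GNS

/-- The GNS representation of a state. -/
def State.rep {A : Type*} [CStarAlgebra A] (f : State A) : A →⋆ₐ[ℂ] (f.GNS →L[ℂ] f.GNS) :=
  f.1.gnsStarAlgHom

/-- The canonical cyclic unit vector of the GNS space of a state. -/
def State.vec {A : Type*} [CStarAlgebra A] (f : State A) : f.GNS :=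
  ((f.1.toPreGNS 1 : f.1.PreGNS) : f.1.GNS)

theorem State.norm_vec {A : Type*} [CStarAlgebra A] (f : State A) : ‖f.vec‖ = 1 := by
  rw [State.vec, UniformSpace.Completion.norm_coe, PositiveLinearMap.preGNS_norm_def]
  simp [f.2]

variable (A B : Type*) [CStarAlgebra A] [CStarAlgebra B]

/-- The Hilbert space tensor product of the GNS spaces of two states. -/
abbrev GNSTensor (s : State A × State B) : Type _ :=
  UniformSpace.Completion (s.1.GNS ⊗[ℂ] s.2.GNS)

instance (s : State A × State B) : Nontrivial (GNSTensor A B s) := by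
  refine ⟨⟨((s.1.vec ⊗ₜ[ℂ] s.2.vec : s.1.GNS ⊗[ℂ] s.2.GNS) : GNSTensor A B s), 0, fun h => ?_⟩⟩
  have h' := congrArg norm h
  rw [UniformSpace.Completion.norm_coe, TensorProduct.norm_tmul, State.norm_vec,
    State.norm_vec, norm_zero] at h'
  norm_num at h'

instance (s : State A × State B) : CStarAlgebra (GNSTensor A B s →L[ℂ] GNSTensor A B s) where

/-- The bounded product, over all pairs `(f, g)` of states of `A` and `B`, of the algebras of bounded
operators on the Hilbert space tensor product of the GNS spaces of `f` and `g`. -/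
abbrev GNSTensorProduct : Type _ := lp (fun s => GNSTensor A B s →L[ℂ] GNSTensor A B s) ∞

variable {A B}

/-- The operator `π_f(a) ⊗ π_g(b)` on the Hilbert space tensor product of the GNS spaces. -/
def tensorOp (s : State A × State B) (a : A) (b : B) : GNSTensor A B s →L[ℂ] GNSTensor A B s :=
  (TensorProduct.mapL (s.1.rep a) (s.2.rep b)).completion

theorem norm_tensorOp_le (s : State A × State B) (a : A) (b : B) :
    ‖tensorOp s a b‖ ≤ ‖a‖ * ‖b‖ := by
  have h : ‖TensorProduct.mapL (s.1.rep a) (s.2.rep b)‖ ≤ ‖a‖ * ‖b‖ :=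
    (TensorProduct.norm_mapL_le _ _).trans
      (mul_le_mul (NonUnitalStarAlgHom.norm_apply_le _ a) (NonUnitalStarAlgHom.norm_apply_le _ b)
        (norm_nonneg _) (norm_nonneg _))
  refine ContinuousLinearMap.opNorm_le_bound _ (by positivity) fun z => ?_
  induction z using UniformSpace.Completion.induction_on with
  | hp => exact isClosed_le (by fun_prop) (by fun_prop)
  | ih z =>
    rw [tensorOp, ContinuousLinearMap.completion_apply_coe, UniformSpace.Completion.norm_coe,
      UniformSpace.Completion.norm_coe]
    exact ContinuousLinearMap.le_of_opNorm_le _ h z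

/-- The elementary tensor `a ⊗ b`, represented on all the spaces `H_f ⊗ H_g`. -/
def elemTensor (a : A) (b : B) : GNSTensorProduct A B :=
  ⟨fun s => tensorOp s a b,
    memℓp_infty ⟨‖a‖ * ‖b‖, by rintro _ ⟨s, rfl⟩; exact norm_tensorOp_le s a b⟩⟩

variable (A B) in
/-- The minimal (spatial) tensor product of two unital C⋆-algebras: the C⋆-algebra generated by
(equivalently, the closed linear span of) the elementary tensors in the tensor product of the
universal representations of `A` and `B`. -/
def MinTensor : Type _ :=
  closedAdjoin {z : GNSTensorProduct A B | ∃ a b, z = elemTensor a b}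

instance : CStarAlgebra (MinTensor A B) :=
  inferInstanceAs (CStarAlgebra
    (closedAdjoin {z : GNSTensorProduct A B | ∃ a b, z = elemTensor a b}))

/-- The elementary tensor `a ⊗ b` in the minimal tensor product. -/
def MinTensor.tmul (a : A) (b : B) : MinTensor A B :=
  ⟨elemTensor a b, subset_closedAdjoin _ ⟨a, b, rfl⟩⟩

end MinTensor

/-! ### Partition quantum spaces -/

section Space

universe u

/-- A nonzero unital C⋆-algebra together with a `d`-tuple of vectors of length `N` that satisfies
the quantum space relations of all partitions in `P`. -/
structure SpaceModel {N d : ℕ} (hd : d ≤ N) (P : Set TwoColouredPartition) :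
    Type (u + 1) where
  alg : Type u
  [cstar : CStarAlgebra alg]
  [nontrivial : Nontrivial alg]
  x : Fin N → Fin d → alg
  rel : ∀ p ∈ P, SpaceRelations hd p x

attribute [instance] SpaceModel.cstar SpaceModel.nontrivial

variable {N d : ℕ} {hd : d ≤ N} {P : Set TwoColouredPartition}

theorem SpaceModel.norm_le_one (hP : mixedColouredPairPartitions ⊆ P)
    (M : SpaceModel.{u} hd P) (i : Fin N) (j : Fin d) : ‖M.x i j‖ ≤ 1 := by
  let _ := CStarAlgebra.spectralOrder M.alg
  have _ := CStarAlgebra.spectralOrderedRing M.alg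
  have h := (M.rel _ (hP (by simp [mixedColouredPairPartitions]))).sum_mul_star j
  have h1 : M.x i j * star (M.x i j) ≤ 1 := by
    rw [← h]
    exact Finset.single_le_sum (f := fun t => M.x t j * star (M.x t j))
      (fun t _ => mul_star_self_nonneg _) (Finset.mem_univ i)
  have h2 := CStarAlgebra.norm_le_norm_of_nonneg_of_le (mul_star_self_nonneg _) h1
  rw [CStarRing.norm_self_mul_star, norm_one] at h2
  nlinarith [norm_nonneg (M.x i j)]

/-- The tuple of all models at once, as elements of the bounded product of all models. -/
def universalTuple (hd : d ≤ N) (hP : mixedColouredPairPartitions ⊆ P) (i : Fin N) (j : Fin d) :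
    lp (fun M : SpaceModel.{u} hd P => M.alg) ∞ :=
  ⟨fun M => M.x i j, memℓp_infty ⟨1, by rintro _ ⟨M, rfl⟩; exact M.norm_le_one hP i j⟩⟩

/-- The universal C⋆-algebra `C(X_{N,d}(P))` generated by `x_{ij}` (`i ∈ [N]`, `j ∈ [d]`) subject to
the relations `R^Sp_p(x)`, `p ∈ P`: the C⋆-algebra generated by the universal tuple inside the
bounded product of all C⋆-algebras with a tuple that satisfies the relations. -/
def SpaceAlgebra (hd : d ≤ N) (hP : mixedColouredPairPartitions ⊆ P) : Type (u + 1) :=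
  closedAdjoin {z | ∃ i j, z = universalTuple.{u} hd hP i j}

variable {hP : mixedColouredPairPartitions ⊆ P}

instance : CStarAlgebra (SpaceAlgebra.{u} hd hP) :=
  inferInstanceAs (CStarAlgebra (closedAdjoin {z | ∃ i j, z = universalTuple.{u} hd hP i j}))

/-- The generators `x_{ij}` of `C(X_{N,d}(P))`. -/
def SpaceAlgebra.gen (hd : d ≤ N) (hP : mixedColouredPairPartitions ⊆ P) (i : Fin N) (j : Fin d) :
    SpaceAlgebra.{u} hd hP :=
  ⟨universalTuple hd hP i j, subset_closedAdjoin _ ⟨i, j, rfl⟩⟩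

end Space

/-! ### Compact matrix quantum groups, actions and quantum symmetry groups -/

section Groups

universe u w

/-- The matrix `v` with entries in the unital C⋆-algebra `A` is the matrix of generators of a compact
matrix quantum group `G` with `C(G) = A`. -/
structure IsCompactMatrixQuantumGroup {A : Type*} [CStarAlgebra A] {N : ℕ}
    (v : Matrix (Fin N) (Fin N) A) : Prop where
  generates : closedAdjoin {a | ∃ i j, a = v i j} = ⊤
  isUnit : IsUnit v
  isUnit_conj : IsUnit (v.map star)
  comul : ∃ Δ : A →⋆ₐ[ℂ] MinTensor A A,
    ∀ i j, Δ (v i j) = ∑ k, MinTensor.tmul (v i k) (v k j)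

/-- There is a left matrix-vector action of the quantum group with matrix of generators `v` on the
quantum space of `d` vectors with generators `x`. -/
def HasLeftAction {A C : Type*} [CStarAlgebra A] [CStarAlgebra C] {N d : ℕ}
    (v : Matrix (Fin N) (Fin N) A) (x : Fin N → Fin d → C) : Prop :=
  ∃ α : C →⋆ₐ[ℂ] MinTensor A C, ∀ i j, α (x i j) = ∑ k, MinTensor.tmul (v i k) (x k j)

/-- There is a right matrix-vector action of the quantum group with matrix of generators `v` on the
quantum space of `d` vectors with generators `x`. -/
def HasRightAction {A C : Type*} [CStarAlgebra A] [CStarAlgebra C] {N d : ℕ}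
    (v : Matrix (Fin N) (Fin N) A) (x : Fin N → Fin d → C) : Prop :=
  ∃ β : C →⋆ₐ[ℂ] MinTensor A C, ∀ i j, β (x i j) = ∑ k, MinTensor.tmul (v k i) (x k j)

/-- The quantum group `G` with matrix of generators `v` is the quantum symmetry group of the quantum
space of `d` vectors with generators `x`: it acts from the left and from the right, and every compact
matrix quantum group `G'` acting from the left and from the right satisfies `G' ⊆ G`, that is, there
is a `*`-homomorphism `C(G) → C(G')` sending the generators `v_{ij}` to the generators `v'_{ij}`. -/
structure IsQuantumSymmetryGroup {A : Type u} {C : Type w} [CStarAlgebra A] [CStarAlgebra C]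
    {N d : ℕ} (v : Matrix (Fin N) (Fin N) A) (x : Fin N → Fin d → C) : Prop where
  isCMQG : IsCompactMatrixQuantumGroup v
  left : HasLeftAction v x
  right : HasRightAction v x
  maximal : ∀ (A' : Type u) [CStarAlgebra A'] (v' : Matrix (Fin N) (Fin N) A'),
    IsCompactMatrixQuantumGroup v' → HasLeftAction v' x → HasRightAction v' x →
      ∃ ψ : A →⋆ₐ[ℂ] A', ∀ i j, ψ (v i j) = v' i j

end Groups

end PartitionQuantumSpace

end

universe u

open PartitionQuantumSpace

noncomputable section

open scoped TensorProduct ENNReal ComplexOrder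

namespace PartitionQuantumSpace

/-! ### The relations under homomorphisms and permutations -/

/-! Only the two actions matter. The elements `∑ k, v i k ⊗ x k j` are images of the generators
under a `*`-homomorphism, so they satisfy the relations. Columns of the identity matrix satisfy the
relations of every partition, so for each injective `c` there is a character `ε` of `C(X_{N,d}(Π))`
with `ε (x k j) = δ_{k,c(j)}` (`SpaceAlgebra.exists_character`). Slicing with `id ⊗ ε` leaves `v i
(c j)`; the right action gives the rows `v (c j) i` in the same way. Row permutations preserve the
relations (`SpaceRelations.permRows`), and the universal property then yields all the homomorphisms.

The map `id ⊗ ε` is never constructed (`SpaceRelations.slice`). In the representations `π_f ⊗ π_ε`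
the second leg acts by the scalars `ε c`, so `a ⊗ c` acts as `π_f (ε c • a) ⊗ 1`. As `f` runs
through all states, the representations `π_f ⊗ 1` separate the points of `A`, so the relations may
be checked there. -/

theorem map_word {A B : Type*} [Ring A] [Star A] [Algebra ℂ A] [Ring B] [Star B]
    [Algebra ℂ B] (φ : A →⋆ₐ[ℂ] B) {N d k : ℕ} (x : Fin N → Fin d → A) (ω : Fin k → Colour)
    (t : Fin k → Fin N) (γ : Fin k → Fin d) :
    φ (word x ω t γ) = word (fun i j => φ (x i j)) ω t γ := by
  have h : ∀ (a : A) c, φ (colourPow a c) = colourPow (φ a) c := by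
    rintro a (_ | _)
    · rfl
    · exact map_star φ a
  simp only [word, map_list_prod, List.map_ofFn, Function.comp_def, h]

theorem map_wordSum {A B : Type*} [Ring A] [Star A] [Algebra ℂ A] [Ring B] [Star B]
    [Algebra ℂ B] (φ : A →⋆ₐ[ℂ] B) {N d k : ℕ} (x : Fin N → Fin d → A) (ω : Fin k → Colour)
    (S : Set (Fin k → Fin N)) (γ : Fin k → Fin d) :
    φ (wordSum x ω S γ) = wordSum (fun i j => φ (x i j)) ω S γ := by
  simp only [wordSum, map_sum, map_word]

theorem SpaceRelations.map {A B : Type*} [Ring A] [Star A] [Algebra ℂ A] [Ring B] [Star B]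
    [Algebra ℂ B] (φ : A →⋆ₐ[ℂ] B)
    {N d : ℕ} {hd : d ≤ N} {p : TwoColouredPartition} {x : Fin N → Fin d → A}
    (h : SpaceRelations hd p x) : SpaceRelations hd p (fun i j => φ (x i j)) where
  rel_eq i j γ γ' hγ hγ' := by
    rw [← map_wordSum, ← map_wordSum, h.rel_eq i j γ γ' hγ hγ']
  rel_upper i γ hγ := by rw [← map_wordSum, h.rel_upper i γ hγ, map_zero]
  rel_lower i γ hγ := by rw [← map_wordSum, h.rel_lower i γ hγ, map_zero]

/-- The relations can be checked in a jointly faithful family of representations, here the `φ s`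
with `Q s`. -/
theorem SpaceRelations.of_forall_map {A : Type*} [Ring A] [Star A] [Algebra ℂ A] {I : Type*}
    {B : I → Type*} [∀ s, Ring (B s)] [∀ s, Star (B s)] [∀ s, Algebra ℂ (B s)]
    (φ : ∀ s, A →⋆ₐ[ℂ] B s) (Q : I → Prop) (hφ : ∀ a b, (∀ s, Q s → φ s a = φ s b) → a = b)
    {N d : ℕ} {hd : d ≤ N} {p : TwoColouredPartition} {x : Fin N → Fin d → A}
    (h : ∀ s, Q s → SpaceRelations hd p (fun i j => φ s (x i j))) : SpaceRelations hd p x where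
  rel_eq i j γ γ' hγ hγ' := hφ _ _ fun s hs => by
    rw [map_wordSum, map_wordSum, (h s hs).rel_eq i j γ γ' hγ hγ']
  rel_upper i γ hγ := hφ _ _ fun s hs => by rw [map_wordSum, (h s hs).rel_upper i γ hγ, map_zero]
  rel_lower i γ hγ := hφ _ _ fun s hs => by rw [map_wordSum, (h s hs).rel_lower i γ hγ, map_zero]

/-! ### Relabeling and disjointness of the index sets `T_i`, `T'_i`. -/

namespace TwoColouredPartition

variable (p : TwoColouredPartition) {N : ℕ}

/-- Membership depends only on equalities between labels, which a bijection preserves and reflects.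
-/
theorem comp_mem_T_iff (σ : Equiv.Perm (Fin N)) (i : p.ThroughBlock → Fin N)
    (t : Fin p.k → Fin N) : σ ∘ t ∈ p.T (σ ∘ i) ↔ t ∈ p.T i := by
  refine and_congr ?_ (forall₂_congr fun _ _ => σ.injective.eq_iff)
  simp only [UpperValid, Function.comp_apply, σ.injective.eq_iff]

theorem comp_mem_T'_iff (σ : Equiv.Perm (Fin N)) (i : p.ThroughBlock → Fin N)
    (t : Fin p.l → Fin N) : σ ∘ t ∈ p.T' (σ ∘ i) ↔ t ∈ p.T' i := by
  refine and_congr ?_ (forall₂_congr fun _ _ => σ.injective.eq_iff)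
  simp only [LowerValid, Function.comp_apply, σ.injective.eq_iff]

variable {p}

/-- Every through-block has an upper point, so a labeling of the upper row determines the labels of
all through-blocks; hence the `T_i` are pairwise disjoint. -/
theorem mem_T_iff_of_mem {i j : p.ThroughBlock → Fin N} {t : Fin p.k → Fin N} (ht : t ∈ p.T j) :
    t ∈ p.T i ↔ i = j := by
  refine ⟨fun h => ?_, fun h => h ▸ ht⟩
  funext ⟨b, hb⟩
  obtain ⟨⟨a, rfl⟩, -⟩ := id hb
  rw [← h.2 a hb, ht.2 a hb]

theorem mem_T'_iff_of_mem {i j : p.ThroughBlock → Fin N} {t : Fin p.l → Fin N}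
    (ht : t ∈ p.T' j) : t ∈ p.T' i ↔ i = j := by
  refine ⟨fun h => ?_, fun h => h ▸ ht⟩
  funext ⟨b, hb⟩
  obtain ⟨-, ⟨a, rfl⟩⟩ := id hb
  rw [← h.2 a hb, ht.2 a hb]

end TwoColouredPartition

theorem wordSum_permRows {A : Type*} [Ring A] [Star A] {N d k : ℕ} (σ : Equiv.Perm (Fin N))
    (x : Fin N → Fin d → A) (ω : Fin k → Colour) {S S' : Set (Fin k → Fin N)}
    (hS : ∀ t, σ ∘ t ∈ S' ↔ t ∈ S) (γ : Fin k → Fin d) :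
    wordSum (fun i j => x (σ i) j) ω S γ = wordSum x ω S' γ := by
  classical
  unfold wordSum
  refine Finset.sum_equiv (Equiv.arrowCongr (Equiv.refl _) σ) (fun t => ?_) fun t _ => rfl
  simp only [Finset.mem_filter, Finset.mem_univ, true_and]
  exact (hS t).symm

/-- The relations are invariant under permutations of the rows. -/
theorem SpaceRelations.permRows {A : Type*} [Ring A] [Star A] {N d : ℕ} {hd : d ≤ N}
    {p : TwoColouredPartition} {x : Fin N → Fin d → A} (h : SpaceRelations hd p x)
    (σ : Equiv.Perm (Fin N)) : SpaceRelations hd p (fun i j => x (σ i) j) where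
  rel_eq i j γ γ' hγ hγ' := by
    rw [wordSum_permRows σ x _ (p.comp_mem_T_iff σ i),
      wordSum_permRows σ x _ (p.comp_mem_T'_iff σ i)]
    exact h.rel_eq _ j γ γ' hγ hγ'
  rel_upper i γ hγ := by
    rw [wordSum_permRows σ x _ (p.comp_mem_T_iff σ i)]
    exact h.rel_upper _ γ hγ
  rel_lower i γ hγ := by
    rw [wordSum_permRows σ x _ (p.comp_mem_T'_iff σ i)]
    exact h.rel_lower _ γ hγ

-- A word in Kronecker deltas vanishes unless `t = c ∘ γ`; the colours play no role because `0` and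
-- `1` are self-adjoint. At most one summand survives.
open Classical in
theorem wordSum_single {N d k : ℕ} (c : Fin d → Fin N) (ω : Fin k → Colour)
    (S : Set (Fin k → Fin N)) (γ : Fin k → Fin d) :
    wordSum (fun i j => if i = c j then (1 : ℂ) else 0) ω S γ = if c ∘ γ ∈ S then 1 else 0 := by
  have hw : ∀ t : Fin k → Fin N, word (fun i j => if i = c j then (1 : ℂ) else 0) ω t γ =
      if t = c ∘ γ then 1 else 0 := by
    intro t
    have hc : ∀ (q : Prop) [Decidable q] (b : Colour),
        colourPow (if q then (1 : ℂ) else 0) b = if q then 1 else 0 := by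
      intro q _ b
      cases b <;> by_cases hq : q <;> simp [colourPow, hq]
    simp only [word, hc, List.prod_ofFn, Finset.prod_ite_zero, Finset.prod_const_one, funext_iff,
      Finset.mem_univ, true_imp_iff, Function.comp_apply]
  simp only [wordSum, hw, Finset.sum_ite_eq', Finset.mem_filter, Finset.mem_univ, true_and]

/-- The first `d` columns of the identity matrix satisfy the relations of every partition. -/
theorem SpaceRelations.single_castLE {N d : ℕ} (hd : d ≤ N) (p : TwoColouredPartition) :
    SpaceRelations hd p (fun i j => if i = Fin.castLE hd j then (1 : ℂ) else 0) where
  rel_eq i j γ γ' hγ hγ' := by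
    classical
    rw [wordSum_single, wordSum_single]
    -- Both sides equal `1` if `i = j` and `0` otherwise.
    exact if_congr ((TwoColouredPartition.mem_T_iff_of_mem hγ).trans
      (TwoColouredPartition.mem_T'_iff_of_mem hγ').symm) rfl rfl
  rel_upper i γ hγ := by
    classical
    rw [wordSum_single]
    exact if_neg fun h => hγ h.1
  rel_lower i γ hγ := by
    classical
    rw [wordSum_single]
    exact if_neg fun h => hγ h.1

/-- Any `d` distinct columns of the identity matrix satisfy the relations of every partition. -/
theorem SpaceRelations.single {N d : ℕ} (hd : d ≤ N) (p : TwoColouredPartition)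
    (c : Fin d ↪ Fin N) :
    SpaceRelations hd p (fun i j => if i = c j then (1 : ℂ) else 0) := by
  -- With `σ` extending `castLE j ↦ c j`, the condition `σ⁻¹ i = castLE j` reads `i = c j`, so a row
  -- permutation moves the first `d` columns to those chosen by `c`.
  obtain ⟨σ, hσ⟩ := Equiv.Perm.exists_extending_pair (Fin.castLE hd) c
    (Fin.castLE_injective hd) c.injective
  have h := (single_castLE hd p).permRows σ.symm
  simpa only [Equiv.symm_apply_eq, hσ] using h

/-! ### The universal property -/

/-- The evaluation of a bounded product at a coordinate. -/
def boundedProductEval {I : Type*} (B : I → Type*) [∀ i, CStarAlgebra (B i)]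
    [∀ i, Nontrivial (B i)] (i : I) : lp B ∞ →⋆ₐ[ℂ] B i where
  toFun z := z i
  map_one' := rfl
  map_mul' _ _ := rfl
  map_zero' := rfl
  map_add' _ _ := rfl
  commutes' _ := rfl
  map_star' _ := rfl

section Space

variable {N d : ℕ} {hd : d ≤ N} {P : Set TwoColouredPartition}
  {hP : mixedColouredPairPartitions ⊆ P}

/-- The representation of `C(X_{N,d}(P))` given by a model. -/
def SpaceAlgebra.toModel (hP : mixedColouredPairPartitions ⊆ P) (M : SpaceModel.{u} hd P) :
    SpaceAlgebra.{u} hd hP →⋆ₐ[ℂ] M.alg :=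
  (boundedProductEval (fun M : SpaceModel.{u} hd P => M.alg) M).comp
    (closedAdjoin {z | ∃ i j, z = universalTuple.{u} hd hP i j}).subtype

theorem SpaceAlgebra.relations_gen {p : TwoColouredPartition} (hp : p ∈ P) :
    SpaceRelations hd p (gen.{u} hd hP) := by
  refine SpaceRelations.of_forall_map (fun M => toModel hP M) (fun _ => True)
    (fun a b hab => ?_) fun M _ => M.rel p hp
  exact Subtype.ext (lp.ext (funext fun M => hab M trivial))

/-- `*`-homomorphisms are contractive, and the `*`-algebra generated by the `x i j` is dense. -/
theorem SpaceAlgebra.hom_ext {B : Type*} [CStarAlgebra B] {φ ψ : SpaceAlgebra.{u} hd hP →⋆ₐ[ℂ] B}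
    (h : ∀ i j, φ (gen hd hP i j) = ψ (gen hd hP i j)) : φ = ψ := by
  have hφ : Continuous φ :=
    AddMonoidHomClass.continuous_of_bound φ 1 fun a => by
      rw [one_mul]; exact NonUnitalStarAlgHom.norm_apply_le φ a
  have hψ : Continuous ψ :=
    AddMonoidHomClass.continuous_of_bound ψ 1 fun a => by
      rw [one_mul]; exact NonUnitalStarAlgHom.norm_apply_le ψ a
  refine StarAlgHom.ext_topologicalClosure
    (S := StarAlgebra.adjoin ℂ {z | ∃ i j, z = universalTuple.{u} hd hP i j})
    hφ hψ (StarAlgHom.ext_adjoin ?_)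
  rintro ⟨_, hx⟩ ⟨i, j, rfl⟩
  exact h i j

/-- A nonzero target with such a tuple is itself one of the models indexing the bounded product, so
the homomorphism is a coordinate projection. The zero algebra is not a model and is treated
separately. -/
theorem SpaceAlgebra.existsUnique_hom {B : Type u} [CStarAlgebra B] {y : Fin N → Fin d → B}
    (hy : ∀ p ∈ P, SpaceRelations hd p y) :
    ∃! φ : SpaceAlgebra.{u} hd hP →⋆ₐ[ℂ] B, ∀ i j, φ (gen hd hP i j) = y i j := by
  refine existsUnique_of_exists_of_unique ?_
    fun φ ψ hφ hψ => hom_ext fun i j => (hφ i j).trans (hψ i j).symm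
  rcases subsingleton_or_nontrivial B with hB | hB
  · exact ⟨{ toFun := fun _ => 0
             map_one' := Subsingleton.elim _ _
             map_mul' := fun _ _ => Subsingleton.elim _ _
             map_zero' := rfl
             map_add' := fun _ _ => Subsingleton.elim _ _
             commutes' := fun _ => Subsingleton.elim _ _
             map_star' := fun _ => Subsingleton.elim _ _ }, fun _ _ => Subsingleton.elim _ _⟩
  · exact ⟨toModel hP ⟨B, y, hy⟩, fun i j => rfl⟩

/-- The character of `C(X_{N,d}(P))` given by `d` distinct columns of the identity matrix. -/
theorem SpaceAlgebra.exists_character (hP : mixedColouredPairPartitions ⊆ P)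
    (c : Fin d ↪ Fin N) : ∃ ε : SpaceAlgebra.{u} hd hP →⋆ₐ[ℂ] ℂ,
      ∀ i j, ε (gen hd hP i j) = if i = c j then 1 else 0 := by
  -- Models live in `Type u`; the functions on a point are a copy of `ℂ` in that universe.
  let ι : ℂ →⋆ₐ[ℂ] C(PUnit.{u + 1}, ℂ) := StarAlgHom.ofId ℂ _
  obtain ⟨φ, hφ, -⟩ := existsUnique_hom (hP := hP)
    fun p _ => (SpaceRelations.single hd p c).map ι
  refine ⟨(ContinuousMap.evalStarAlgHom ℂ ℂ PUnit.unit).comp φ, fun i j => ?_⟩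
  rw [StarAlgHom.comp_apply, hφ]
  split_ifs <;> simp [ι]

end Space

/-! ### States and slices of the minimal tensor product -/

section States

attribute [local instance] CStarAlgebra.spectralOrder CStarAlgebra.spectralOrderedRing

/-- A nonzero positive element of a C⋆-algebra is detected by some state. -/
theorem State.exists_apply_ne_zero {A : Type*} [CStarAlgebra A] {b : A} (hb : 0 ≤ b)
    (hb0 : b ≠ 0) : ∃ f : State A, f.1 b ≠ 0 := by
  -- Hahn–Banach separates `-b` from the closed cone of positive elements; the separating functional
  -- is then made positive and normalised.
  have hnb : -b ∉ {a : A | 0 ≤ a} := fun h => hb0 (le_antisymm (neg_nonneg.mp h) hb)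
  obtain ⟨g, u, hgu, hg⟩ := geometric_hahn_banach_point_closed
    (t := {a : A | 0 ≤ a}) (convex_Ici (𝕜 := ℝ) (0 : A)) CStarAlgebra.isClosed_nonneg hnb
  have hu : u < 0 := by simpa using hg 0 (Set.mem_ofPred_eq ▸ le_rfl)
  have hgb : 0 < g b := by
    have : g (-b) = - g b := map_neg g b
    linarith
  have hpos : ∀ a : A, 0 ≤ a → 0 ≤ g a := by
    intro a ha
    by_contra! hlt
    -- This multiple of `a` stays in the cone, yet `g` takes the value `u` on it, against the strict
    -- bound.
    have hmem : (0 : A) ≤ (u / g a) • a := smul_nonneg (div_nonneg_of_nonpos hu.le hlt.le) ha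
    have := hg _ hmem
    rw [map_smul, smul_eq_mul, div_mul_cancel₀ _ hlt.ne] at this
    exact lt_irrefl _ this
  -- Symmetrising makes the functional vanish on `i • a` for self-adjoint `a`, so its complex-linear
  -- extension is real there and agrees with `g` on positive elements.
  let gs : A →ₗ[ℝ] ℝ :=
    { toFun := fun a => (g a + g (star a)) / 2
      map_add' := fun a c => by simp only [star_add, map_add]; ring
      map_smul' := fun r a => by
        simp only [star_smul, map_smul, star_trivial, smul_eq_mul, RingHom.id_apply]; ring }
  let F : A →ₗ[ℂ] ℂ := Module.Dual.extendRCLike gs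
  have hF : ∀ a : A, 0 ≤ a → F a = (g a : ℂ) := by
    intro a ha
    have h1 : gs a = g a := by
      simp only [gs, LinearMap.coe_mk, AddHom.coe_mk, (IsSelfAdjoint.of_nonneg ha).star_eq]
      ring
    have h2 : gs (Complex.I • a) = 0 := by
      simp [gs, star_smul, (IsSelfAdjoint.of_nonneg ha).star_eq]
    rw [Module.Dual.extendRCLike_apply]
    simp [h1, h2]
  have hg1 : 0 < g 1 := by
    -- From `b ≤ ‖b‖ • 1` one gets `0 < g b ≤ ‖b‖ * g 1`.
    have h := hpos _ (sub_nonneg.mpr (IsSelfAdjoint.of_nonneg hb).le_algebraMap_norm_self)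
    rw [Algebra.algebraMap_eq_smul_one, map_sub, map_smul, smul_eq_mul] at h
    by_contra! hle
    nlinarith [norm_nonneg b]
  let f : A →ₚ[ℂ] ℂ := PositiveLinearMap.mk₀ (((g 1)⁻¹ : ℂ) • F) fun a ha => by
    rw [LinearMap.smul_apply, hF a ha, smul_eq_mul]
    exact_mod_cast mul_nonneg (inv_nonneg.mpr hg1.le) (hpos a ha)
  have hf : ∀ a, f a = ((g 1)⁻¹ : ℂ) * F a := fun a => rfl
  have hg1' : (g 1 : ℂ) ≠ 0 := by exact_mod_cast hg1.ne'
  refine ⟨⟨f, ?_⟩, ?_⟩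
  · rw [hf, hF 1 zero_le_one, inv_mul_cancel₀ hg1']
  · change f b ≠ 0
    rw [hf, hF b hb]
    exact mul_ne_zero (inv_ne_zero hg1') (by exact_mod_cast hgb.ne')

variable {A C : Type*} [CStarAlgebra A] [CStarAlgebra C]

/-- A character, regarded as a state. -/
def State.ofCharacter (ε : C →⋆ₐ[ℂ] ℂ) : State C :=
  ⟨PositiveLinearMap.mk₀ (ε : C →ₗ[ℂ] ℂ) fun _ ha => map_nonneg ε ha, map_one ε⟩

theorem State.ofCharacter_apply (ε : C →⋆ₐ[ℂ] ℂ) (c : C) : (State.ofCharacter ε).1 c = ε c := rfl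

theorem State.rep_coe (f : State C) (c : C) (x : f.1.PreGNS) :
    f.rep c (x : f.GNS) = ((f.1.toPreGNS (c * f.1.ofPreGNS x) : f.1.PreGNS) : f.GNS) :=
  f.1.gnsNonUnitalStarAlgHom_apply_coe

theorem coe_completion_eq_of_norm_sub {E : Type*} [SeminormedAddCommGroup E] {x y : E}
    (h : ‖x - y‖ = 0) : (x : UniformSpace.Completion E) = y := by
  rw [← dist_eq_zero, UniformSpace.Completion.dist_eq, dist_eq_norm, h]

/-- The GNS representation of a character acts by scalars. -/
theorem State.rep_ofCharacter (ε : C →⋆ₐ[ℂ] ℂ) (c : C) (z : (State.ofCharacter ε).GNS) :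
    (State.ofCharacter ε).rep c z = ε c • z := by
  induction z using UniformSpace.Completion.induction_on with
  | hp => exact isClosed_eq (ContinuousLinearMap.continuous _) (continuous_const_smul (ε c))
  | ih x =>
    rw [State.rep_coe, ← UniformSpace.Completion.coe_smul]
    refine coe_completion_eq_of_norm_sub ?_
    -- The difference lies in the kernel of the multiplicative `ε`, hence is a null vector of the
    -- GNS seminorm and vanishes in the completion.
    have h : ε (c * (State.ofCharacter ε).1.ofPreGNS x -
        ε c • (State.ofCharacter ε).1.ofPreGNS x) = 0 := by
      rw [map_sub, map_mul, map_smul, smul_eq_mul, sub_self]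
    rw [PositiveLinearMap.preGNS_norm_def, State.ofCharacter_apply, map_mul]
    erw [h]
    rw [mul_zero, Complex.zero_re, Real.sqrt_zero]

/-- The GNS identity `‖π_f(a) ξ_f‖² = f(a* a)`. -/
theorem State.rep_vec_eq_zero {f : State A} {a : A} (h : f.rep a f.vec = 0) :
    f.1 (star a * a) = 0 := by
  rw [State.vec, State.rep_coe, ← norm_eq_zero, UniformSpace.Completion.norm_coe,
    PositiveLinearMap.ofPreGNS_toPreGNS, mul_one] at h
  have := f.1.preGNS_norm_sq (f.1.toPreGNS a)
  rw [h, PositiveLinearMap.ofPreGNS_toPreGNS] at this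
  simpa using this.symm

/-! ### The operators `π_f(a) ⊗ π_g(c)` and their slices. -/

theorem tensorOp_coe_tmul (s : State A × State C) (a : A) (c : C) (x : s.1.GNS) (y : s.2.GNS) :
    tensorOp s a c ((x ⊗ₜ[ℂ] y : s.1.GNS ⊗[ℂ] s.2.GNS) : GNSTensor A C s) =
      ((s.1.rep a x ⊗ₜ[ℂ] s.2.rep c y : s.1.GNS ⊗[ℂ] s.2.GNS) : GNSTensor A C s) := by
  rw [tensorOp, ContinuousLinearMap.completion_apply_coe, TensorProduct.mapL_tmul]

/-- Elementary tensors span a dense subspace. -/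
theorem GNSTensor.clm_ext {s : State A × State C}
    {S T : GNSTensor A C s →L[ℂ] GNSTensor A C s}
    (h : ∀ (x : s.1.GNS) (y : s.2.GNS),
      S ((x ⊗ₜ[ℂ] y : s.1.GNS ⊗[ℂ] s.2.GNS) : GNSTensor A C s) =
        T ((x ⊗ₜ[ℂ] y : s.1.GNS ⊗[ℂ] s.2.GNS) : GNSTensor A C s)) : S = T := by
  ext z
  induction z using UniformSpace.Completion.induction_on with
  | hp => exact isClosed_eq (by fun_prop) (by fun_prop)
  | ih z =>
    induction z using TensorProduct.induction_on with
    | zero => rw [UniformSpace.Completion.coe_zero, map_zero, map_zero]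
    | tmul x y => exact h x y
    | add x y hx hy => rw [UniformSpace.Completion.coe_add, map_add, map_add, hx, hy]

theorem tensorOp_add_left (s : State A × State C) (a b : A) (c : C) :
    tensorOp s (a + b) c = tensorOp s a c + tensorOp s b c :=
  GNSTensor.clm_ext fun x y => by
    simp only [tensorOp_coe_tmul, add_apply, map_add, TensorProduct.add_tmul,
      UniformSpace.Completion.coe_add]

theorem tensorOp_smul_left (s : State A × State C) (r : ℂ) (a : A) (c : C) :
    tensorOp s (r • a) c = r • tensorOp s a c :=
  GNSTensor.clm_ext fun x y => by
    simp only [tensorOp_coe_tmul, smul_apply, map_smul,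
      ← TensorProduct.smul_tmul', UniformSpace.Completion.coe_smul]

theorem tensorOp_one_one (s : State A × State C) : tensorOp s (1 : A) (1 : C) = 1 :=
  GNSTensor.clm_ext fun x y => by
    simp only [tensorOp_coe_tmul, one_apply_eq_self, map_one]

theorem tensorOp_mul (s : State A × State C) (a b : A) (c e : C) :
    tensorOp s (a * b) (c * e) = tensorOp s a c * tensorOp s b e :=
  GNSTensor.clm_ext fun x y => by
    simp only [tensorOp_coe_tmul, mul_apply_eq_comp, map_mul]

theorem tensorOp_star (s : State A × State C) (a : A) (c : C) :
    tensorOp s (star a) (star c) = star (tensorOp s a c) := by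
  rw [ContinuousLinearMap.star_eq_adjoint]
  refine (ContinuousLinearMap.eq_adjoint_iff _ _).mpr fun z w => ?_
  induction z, w using UniformSpace.Completion.induction_on₂ with
  | hp => exact isClosed_eq (by fun_prop) (by fun_prop)
  | ih z w =>
    induction z using TensorProduct.induction_on with
    | zero => rw [UniformSpace.Completion.coe_zero, map_zero, inner_zero_left, inner_zero_left]
    | add x y hx hy =>
      rw [UniformSpace.Completion.coe_add, map_add, inner_add_left, inner_add_left, hx, hy]
    | tmul x y =>
      induction w using TensorProduct.induction_on with
      | zero =>
        rw [UniformSpace.Completion.coe_zero, map_zero, inner_zero_right, inner_zero_right]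
      | add x y hx hy =>
        rw [UniformSpace.Completion.coe_add, map_add, inner_add_right, inner_add_right, hx, hy]
      | tmul x' y' =>
        rw [tensorOp_coe_tmul, tensorOp_coe_tmul, UniformSpace.Completion.inner_coe,
          UniformSpace.Completion.inner_coe, TensorProduct.inner_tmul, TensorProduct.inner_tmul,
          map_star, map_star, ContinuousLinearMap.star_eq_adjoint,
          ContinuousLinearMap.star_eq_adjoint, ContinuousLinearMap.adjoint_inner_left,
          ContinuousLinearMap.adjoint_inner_left]

theorem tensorOp_algebraMap (s : State A × State C) (r : ℂ) :
    tensorOp s (algebraMap ℂ A r) (1 : C) = r • 1 := by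
  rw [Algebra.algebraMap_eq_smul_one, tensorOp_smul_left, tensorOp_one_one]

/-- The representation `a ↦ π_f(a) ⊗ 1` on the Hilbert space tensor product of GNS spaces. -/
def tensorOpLeft (s : State A × State C) : A →⋆ₐ[ℂ] (GNSTensor A C s →L[ℂ] GNSTensor A C s) where
  toFun a := tensorOp s a 1
  map_one' := tensorOp_one_one s
  map_mul' a b := by rw [← tensorOp_mul, mul_one]
  map_zero' := by simpa only [zero_smul] using tensorOp_smul_left s 0 0 1
  map_add' a b := tensorOp_add_left s a b 1
  commutes' r := tensorOp_algebraMap s r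
  map_star' a := by rw [← tensorOp_star, star_one]

theorem tensorOpLeft_apply (s : State A × State C) (a : A) : tensorOpLeft s a = tensorOp s a 1 :=
  rfl

/-- `π_ε(c)` is the scalar `ε c`, which moves across the tensor sign; this stands in for the slice
map `id ⊗ ε`. -/
theorem tensorOp_ofCharacter {s : State A × State C} {ε : C →⋆ₐ[ℂ] ℂ}
    (hs : s.2 = State.ofCharacter ε) (a : A) (c : C) :
    tensorOp s a c = tensorOpLeft s (ε c • a) := by
  obtain ⟨f, g⟩ := s
  obtain rfl : g = State.ofCharacter ε := hs
  rw [tensorOpLeft_apply, tensorOp_smul_left]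
  refine GNSTensor.clm_ext fun x y => ?_
  rw [smul_apply, tensorOp_coe_tmul, tensorOp_coe_tmul,
    State.rep_ofCharacter, map_one, one_apply_eq_self,
    TensorProduct.tmul_smul, UniformSpace.Completion.coe_smul]

/-- For a fixed state `g`, the representations `π_f ⊗ 1` on `H_f ⊗ H_g` are jointly faithful. -/
theorem eq_of_forall_tensorOpLeft (g : State C) {a b : A}
    (h : ∀ s : State A × State C, s.2 = g → tensorOpLeft s a = tensorOpLeft s b) : a = b := by
  rw [← sub_eq_zero]
  by_contra ha
  obtain ⟨f, hf⟩ := State.exists_apply_ne_zero (star_mul_self_nonneg (a - b))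
    (fun h0 => ha ((CStarRing.star_mul_self_eq_zero_iff _).mp h0))
  refine hf (State.rep_vec_eq_zero ?_)
  have h1 : tensorOp (f, g) (a - b) 1 = 0 := by
    rw [← tensorOpLeft_apply, map_sub, h (f, g) rfl, sub_self]
  -- Evaluation at `ξ_f ⊗ ξ_g` with `‖ξ_g‖ = 1` gives `‖π_f(a - b) ξ_f‖ = 0`, contradicting the
  -- choice of `f`.
  have h2 := tensorOp_coe_tmul (f, g) (a - b) 1 f.vec g.vec
  rw [h1, zero_apply] at h2
  have h3 := congrArg norm h2.symm
  rwa [UniformSpace.Completion.norm_coe, TensorProduct.norm_tmul, map_one, one_apply_eq_self,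
    State.norm_vec, mul_one, norm_zero, norm_eq_zero] at h3

/-- The representation of the minimal tensor product on `H_f ⊗ H_g`. -/
def MinTensor.rep (s : State A × State C) :
    MinTensor A C →⋆ₐ[ℂ] (GNSTensor A C s →L[ℂ] GNSTensor A C s) :=
  (boundedProductEval (fun s => GNSTensor A C s →L[ℂ] GNSTensor A C s) s).comp
    (closedAdjoin {z : GNSTensorProduct A C | ∃ a b, z = elemTensor a b}).subtype

theorem MinTensor.rep_tmul (s : State A × State C) (a : A) (c : C) :
    MinTensor.rep s (MinTensor.tmul a c) = tensorOp s a c := rfl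

/-- Applying a character to the second tensor leg preserves the quantum space relations. -/
theorem SpaceRelations.slice (ε : C →⋆ₐ[ℂ] ℂ) {N d n : ℕ} {hd : d ≤ N} {p : TwoColouredPartition}
    {a : Fin N → Fin d → Fin n → A} {c : Fin N → Fin d → Fin n → C}
    (h : SpaceRelations hd p (fun i j => ∑ k, MinTensor.tmul (a i j k) (c i j k))) :
    SpaceRelations hd p (fun i j => ∑ k, ε (c i j k) • a i j k) := by
  refine SpaceRelations.of_forall_map (fun s : State A × State C => tensorOpLeft s)
    (fun s => s.2 = State.ofCharacter ε) (fun _ _ => eq_of_forall_tensorOpLeft _) fun s hs => ?_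
  have h' := h.map (MinTensor.rep s)
  simpa only [map_sum, MinTensor.rep_tmul, tensorOp_ofCharacter hs] using h'

end States

/-! ### Columns of the matrix of generators -/

section Actions

variable {N d : ℕ} {hd : d ≤ N} {P : Set TwoColouredPartition}
  {hP : mixedColouredPairPartitions ⊆ P} {A : Type*} [CStarAlgebra A]
  {v : Matrix (Fin N) (Fin N) A}

/-- Slicing `∑ k, v i k ⊗ x k j` at the character `x k j ↦ δ_{k,c(j)}` keeps only the term `k = c
j`. -/
theorem HasLeftAction.relations_columns (h : HasLeftAction v (SpaceAlgebra.gen.{u} hd hP))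
    {p : TwoColouredPartition} (hp : p ∈ P) (c : Fin d ↪ Fin N) :
    SpaceRelations hd p (fun i j => v i (c j)) := by
  obtain ⟨α, hα⟩ := h
  obtain ⟨ε, hε⟩ := SpaceAlgebra.exists_character.{u} (hd := hd) hP c
  have h := (SpaceAlgebra.relations_gen (hd := hd) (hP := hP) hp).map α
  simp only [hα] at h
  simpa [hε] using h.slice ε

theorem HasRightAction.relations_rows (h : HasRightAction v (SpaceAlgebra.gen.{u} hd hP))
    {p : TwoColouredPartition} (hp : p ∈ P) (c : Fin d ↪ Fin N) :
    SpaceRelations hd p (fun i j => v (c j) i) := by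
  obtain ⟨β, hβ⟩ := h
  obtain ⟨ε, hε⟩ := SpaceAlgebra.exists_character.{u} (hd := hd) hP c
  have h := (SpaceAlgebra.relations_gen (hd := hd) (hP := hP) hp).map β
  simp only [hβ] at h
  simpa [hε] using h.slice ε

end Actions

end PartitionQuantumSpace

end

theorem mainTheorem3 (N d : ℕ) (hd₁ : 1 ≤ d) (hd : d ≤ N)
    (P : Set TwoColouredPartition) (hP : mixedColouredPairPartitions ⊆ P)
    (A : Type u) [CStarAlgebra A] (v : Matrix (Fin N) (Fin N) A)
    (hG : IsQuantumSymmetryGroup v (SpaceAlgebra.gen.{u} hd hP)) :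
    (∀ σ₁ σ₂ : Equiv.Perm (Fin N),
      (∃! φ : SpaceAlgebra.{u} hd hP →⋆ₐ[ℂ] A,
        ∀ i j, φ (SpaceAlgebra.gen hd hP i j) = v (σ₁ i) (σ₂ (Fin.castLE hd j))) ∧
      (∃! φT : SpaceAlgebra.{u} hd hP →⋆ₐ[ℂ] A,
        ∀ i j, φT (SpaceAlgebra.gen hd hP i j) = v (σ₂ (Fin.castLE hd j)) (σ₁ i))) ∧
    (∃! φ : SpaceAlgebra.{u} hd hP →⋆ₐ[ℂ] A,
      ∀ i j, φ (SpaceAlgebra.gen hd hP i j) = v i (Fin.castLE hd j)) ∧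
    (∀ p ∈ P, ∀ c : Fin d ↪ Fin N,
      SpaceRelations hd p (fun i j => v i (c j)) ∧
      SpaceRelations hd p (fun i j => v (c j) i)) := by
  have hleft := fun p hp => hG.left.relations_columns (p := p) hp
  have hright := fun p hp => hG.right.relations_rows (p := p) hp
  -- `σ₂` is absorbed into the choice of columns (or rows of `v` for `φT`), while `σ₁` acts by row
  -- permutation of the resulting tuple.
  let c : Equiv.Perm (Fin N) → (Fin d ↪ Fin N) := fun σ =>
    (Fin.castLEEmb hd).trans σ.toEmbedding
  exact ⟨fun σ₁ σ₂ =>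
      ⟨SpaceAlgebra.existsUnique_hom fun p hp => (hleft p hp (c σ₂)).permRows σ₁,
        SpaceAlgebra.existsUnique_hom fun p hp => (hright p hp (c σ₂)).permRows σ₁⟩,
    SpaceAlgebra.existsUnique_hom fun p hp => hleft p hp (Fin.castLEEmb hd),
    fun p hp c => ⟨hleft p hp c, hright p hp c⟩⟩
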